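/- Let $0<H<1/2$, $\lambda>0$ and $\nu=\sqrt{\lambda^2/(H(1-2H))}$. On a probability space let $G$ be a centred Gaussian white noise on the upper half-plane $\{(s,h): h>0\}$ with control measure $dp_H(s,h)=\lambda^2h^{2H-2}\,dh\,ds$; that is, $(G(A))$, indexed by the Borel sets $A$ with $p_H(A)<\infty$, is a centred Gaussian process with $\mathrm{Cov}(G(A),G(A'))=p_H(A\cap A')$. For $T>0$ and $t\in\mathbb R$ let $C_T(t)=\{(s,h): h>0,\ |s-t|<\tfrac12\min(h,T)\}$ and $C(t)=\{(s,h): h>0,\ |s-t|<\tfrac h2\}$. The S-fBM process with mean $m_T\in\mathbb R$ is the process with almost surely continuous paths such that, for each $t\in\mathbb R$, $\omega_{H,T}(t)=m_T+G(C_T(t))$ almost surely (for instance with $m_T$ chosen so that $\mathbb E[e^{\omega_{H,T}(t)}]=1$). Then, for every $T>0$ and $m_T\in\mathbb R$, such a process $\omega_{H,T}$ exists, and there is a fractional Brownian motion $(B_H(t))_{t\in\mathbb R}$ of Hurst index $H$, with almost surely continuous paths and unit variance at $t=1$, given for each $t\in\mathbb R$ by the cone construction $$\nu B_H(t)=G\big(C(t)\setminus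 C(0)\big)-G\big(C(0)\setminus C(t)\big)\quad\text{almost surely},$$ such that, for all choices of the means $m_T$ and of the processes $\omega_{H,T}$ $(T>0)$ as above, and for every $t_0>0$, $$\lim_{T\to\infty}\mathbb E\Big[\sup_{t\in[0,t_0]}\big|\omega_{H,T}(t)-\omega_{H,T}(0)-\nu B_H(t)\big|\Big]=0 .$$ -/

import Mathlib

open MeasureTheory ProbabilityTheory Filter Topology Set
open scoped ENNReal

noncomputable section

namespace SfBM

/-- `G` is a (real, centred) Gaussian white noise with control measure `μ`, under the probability
`P`: the random variables `G A`, indexed by the measurable sets `A` of finite `μ`-measure, form a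
centred Gaussian process with `Cov (G A) (G B) = μ (A ∩ B)`. In particular `G A` has variance
`μ A`, and `G` is independent and almost surely additive on disjoint sets. The stochastic integral
`∫_A dG` is `G A`; the values of `G` on all other sets are irrelevant. -/
structure IsGaussianWhiteNoise {S Ω : Type*} [MeasurableSpace S] [MeasurableSpace Ω]
    (G : Set S → Ω → ℝ) (μ : Measure S) (P : Measure Ω) : Prop where
  isGaussianProcess :
    IsGaussianProcess (fun A : {A : Set S // MeasurableSet A ∧ μ A < ∞} => G A.1) P
  centred : ∀ A : Set S, MeasurableSet A → μ A < ∞ → ∫ w, G A w ∂P = 0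
  covariance : ∀ A B : Set S, MeasurableSet A → μ A < ∞ → MeasurableSet B → μ B < ∞ →
    covariance (G A) (G B) P = (μ (A ∩ B)).toReal

/-- The measure `dp_H(t,h) = λ² h^(2H-2) dh dt` on the open upper half-plane `{(t,h) | 0 < h}`. -/
def controlMeasure (H lam : ℝ) : Measure (ℝ × ℝ) :=
  ((volume : Measure (ℝ × ℝ)).restrict {p | 0 < p.2}).withDensity
    (fun p => ENNReal.ofReal (lam ^ 2 * p.2 ^ (2 * H - 2)))

/-- The truncated cone `C_T(t) = {(s,h) | h > 0, |s - t| < min(h,T)/2}`. -/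
def truncCone (T t : ℝ) : Set (ℝ × ℝ) :=
  {p | 0 < p.2 ∧ |p.1 - t| < min p.2 T / 2}

/-- The full cone `C(t) = {(s,h) | h > 0, |s - t| < h/2}`. -/
def cone (t : ℝ) : Set (ℝ × ℝ) :=
  {p | 0 < p.2 ∧ |p.1 - t| < p.2 / 2}

/-- `D₊(t) = C(t) \ C(0)`. -/
def coneDiffPlus (t : ℝ) : Set (ℝ × ℝ) := cone t \ cone 0

/-- `D₋(t) = C(0) \ C(t)`. -/
def coneDiffMinus (t : ℝ) : Set (ℝ × ℝ) := cone 0 \ cone t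

/-- The amplitude `ν > 0` with `ν² = λ² / (H (1 - 2H))`. -/
def amplitude (H lam : ℝ) : ℝ := Real.sqrt (lam ^ 2 / (H * (1 - 2 * H)))

/-- `X` is a version, with almost surely continuous paths, of the stationary fractional Brownian
motion `ω_{H,T}(t) = m + ∫_{C_T(t)} dG`, with decorrelation time `T`, mean `m` and driving
noise `G` (the parameters `H` and `λ` enter through the control measure of `G`). -/
structure IsStationaryFBM {Ω : Type*} [MeasurableSpace Ω] (G : Set (ℝ × ℝ) → Ω → ℝ)
    (T m : ℝ) (X : ℝ → Ω → ℝ) (P : Measure Ω) : Prop where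
  eq_noise : ∀ t : ℝ, X t =ᵐ[P] fun w => m + G (truncCone T t) w
  continuous_paths : ∀ᵐ w ∂P, Continuous fun t => X t w

/-- `B` is a (two-sided) fractional Brownian motion of Hurst index `H`, with unit variance at
`t = 1`: a centred Gaussian process with covariance `(|s|^(2H) + |t|^(2H) - |t - s|^(2H)) / 2` and
almost surely continuous paths. -/
structure IsFractionalBrownianMotion {Ω : Type*} [MeasurableSpace Ω] (H : ℝ)
    (B : ℝ → Ω → ℝ) (P : Measure Ω) : Prop where
  isGaussianProcess : IsGaussianProcess B P
  centred : ∀ t : ℝ, ∫ w, B t w ∂P = 0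
  covariance : ∀ s t : ℝ, covariance (B s) (B t) P =
    (|s| ^ (2 * H) + |t| ^ (2 * H) - |t - s| ^ (2 * H)) / 2
  continuous_paths : ∀ᵐ w ∂P, Continuous fun t => B t w

end SfBM

end

/-!
The processes `ω_{H,T}(t) - ω_{H,T}(0) - ν B_H(t)` are almost surely stochastic integrals of
explicit step functions, so everything reduces to `L²` norms of step functions on the half-plane,
followed by Kolmogorov's chaining argument.

*Gaussian part.* For a step function `f = ∑ c_A 1_A`, the integral `∫ f dG = ∑ c_A G(A)` is a centred
Gaussian variable of variance `∫ f² dμ` (`covariance_wienerInt`), so `E|∫ f dG|^p` is `‖f‖₂^p` times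
the `p`-th moment of a standard Gaussian variable (`lintegral_enorm_wienerInt_rpow`). A Hölder bound
`‖f_t - f_s‖₂² ≤ κ |t - s|^θ` thus gives Kolmogorov's condition with exponent `θ p / 2`, which
exceeds `1` once `p` is large.

*Chaining.* If `E|Z_t - Z_s|^p ≤ K |t - s|^q` with `q > 1`, summing the increments over dyadic
intervals gives a continuous modification (`exists_continuous_modification`) and, for continuous
`Z`, the bound `E sup_{[0,N]} |Z_t - Z_0| ≤ C K^(1/p)`, where `C` depends only on `N`, `p`, `q`
(`lintegral_iSup_edist_le`).

*Geometry.* At height `h` all cones are intervals, and two intervals of radius `r` have symmetric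
difference of length `2 min (2r, |t - s|)`. Integrating against `λ² h^(2H-2)` gives
`‖1_{C(t)} - 1_{C(s)}‖₂² = ν² |t - s|^(2H)` (`lintegral_cone_sub_sq`), which by polarization is the
covariance of `ν B_H`, and the same upper bound for the truncated cones. The truncated and the full
cones agree below height `T`, so the integrand of the difference process has increments with squared
`L²` norm at most a constant times `T^(2H-1) |t - s|` (`lintegral_truncCone_sub_cone_sq_le`). The
maximal inequality with `p = 4`, `q = 2` bounds the expected supremum by a constant times
`T^(H-1/2)`, which tends to `0` because `H < 1/2`.
-/

namespace SfBM

/-! ### Stochastic integrals of step functions -/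

section Wiener

variable {S Ω : Type*} [MeasurableSpace S]

/-- The index set of a white noise with control measure `μ`. -/
abbrev FinMeasSet (μ : Measure S) : Type _ := {A : Set S // MeasurableSet A ∧ μ A < ∞}

/-- A finitely supported family of coefficients `c`, seen as the step function `∑ c_A 1_A`. -/
noncomputable def stepFun {μ : Measure S} (c : FinMeasSet μ →₀ ℝ) (x : S) : ℝ :=
  Finsupp.linearCombination ℝ (fun A : FinMeasSet μ => A.1.indicator (fun _ => (1 : ℝ)) x) c

/-- The stochastic integral `∑ c_A G(A)` of the step function `∑ c_A 1_A`. It is indexed by the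
coefficients rather than by the step function, so that it is linear everywhere on `Ω`. -/
noncomputable def wienerInt (G : Set S → Ω → ℝ) {μ : Measure S} (c : FinMeasSet μ →₀ ℝ)
    (w : Ω) : ℝ :=
  Finsupp.linearCombination ℝ (fun A : FinMeasSet μ => G A.1 w) c

variable {G : Set S → Ω → ℝ} {μ : Measure S}

lemma wienerInt_single (A : FinMeasSet μ) (a : ℝ) (w : Ω) :
    wienerInt G (Finsupp.single A a) w = a * G A.1 w := by
  simp [wienerInt]

lemma stepFun_single (A : FinMeasSet μ) (a : ℝ) (x : S) :
    stepFun (Finsupp.single A a) x = a * A.1.indicator (fun _ => (1 : ℝ)) x := by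
  simp [stepFun]

lemma wienerInt_sub (c d : FinMeasSet μ →₀ ℝ) (w : Ω) :
    wienerInt G (c - d) w = wienerInt G c w - wienerInt G d w := map_sub _ _ _

lemma wienerInt_smul (a : ℝ) (c : FinMeasSet μ →₀ ℝ) (w : Ω) :
    wienerInt G (a • c) w = a * wienerInt G c w := map_smul _ _ _

lemma stepFun_sub (c d : FinMeasSet μ →₀ ℝ) (x : S) :
    stepFun (c - d) x = stepFun c x - stepFun d x := map_sub _ _ _

lemma memLp_stepFun (c : FinMeasSet μ →₀ ℝ) : MemLp (stepFun c) 2 μ := by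
  have h : stepFun c = fun x => ∑ A ∈ c.support, c A * A.1.indicator (fun _ => (1 : ℝ)) x := by
    ext x
    simp [stepFun, Finsupp.linearCombination_apply, Finsupp.sum]
  rw [h]
  refine memLp_finsetSum _ fun A _ => MemLp.const_mul ?_ _
  exact memLp_indicator_const 2 A.2.1 1 (Or.inr A.2.2.ne)

lemma lintegral_enorm_stepFun_sq (c : FinMeasSet μ →₀ ℝ) :
    ∫⁻ x, ‖stepFun c x‖ₑ ^ (2 : ℝ) ∂μ = ENNReal.ofReal (∫ x, stepFun c x * stepFun c x ∂μ) := by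
  refine Eq.trans (lintegral_congr fun x => ?_) (ofReal_integral_eq_lintegral_ofReal
    ((memLp_stepFun c).integrable_mul (memLp_stepFun c))
    (Eventually.of_forall fun x => mul_self_nonneg _)).symm
  rw [← ofReal_norm, ENNReal.ofReal_rpow_of_nonneg (norm_nonneg _) (by norm_num)]
  congr 1
  simp [sq]

/-- The absolute moment `E|N|^p` of a standard Gaussian variable. -/
noncomputable def gaussianMoment (p : ℝ) : ℝ≥0∞ :=
  ∫⁻ x, ‖x‖ₑ ^ p ∂gaussianReal 0 1

lemma gaussianMoment_ne_top {p : ℝ} (hp : 0 < p) : gaussianMoment p ≠ ∞ := by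
  have h := memLp_id_gaussianReal' (μ := 0) (v := 1) (ENNReal.ofReal p) ENNReal.ofReal_ne_top
  have := h.2
  rw [eLpNorm_lt_top_iff_lintegral_rpow_enorm_lt_top (by simpa using hp)
    ENNReal.ofReal_ne_top, ENNReal.toReal_ofReal hp.le] at this
  exact this.ne

variable [MeasurableSpace Ω] {P : Measure Ω}

namespace IsGaussianWhiteNoise

lemma isGaussianProcess_wienerInt (hG : IsGaussianWhiteNoise G μ P) :
    IsGaussianProcess (fun c : FinMeasSet μ →₀ ℝ => wienerInt G c) P := by
  refine hG.isGaussianProcess.of_isGaussianProcess fun c => ⟨c.support,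
    ∑ A : c.support, c A.1 • ContinuousLinearMap.proj (R := ℝ) (φ := fun _ => ℝ) A, fun w => ?_⟩
  simp only [wienerInt, Finsupp.linearCombination_apply, Finsupp.sum]
  rw [← Finset.sum_coe_sort]
  simp

lemma memLp_wienerInt (hG : IsGaussianWhiteNoise G μ P) (c : FinMeasSet μ →₀ ℝ) :
    MemLp (wienerInt G c) 2 P :=
  (hG.isGaussianProcess_wienerInt.hasGaussianLaw_eval c).memLp_two

lemma aemeasurable_wienerInt (hG : IsGaussianWhiteNoise G μ P) (c : FinMeasSet μ →₀ ℝ) :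
    AEMeasurable (wienerInt G c) P :=
  hG.isGaussianProcess_wienerInt.aemeasurable c

lemma integral_wienerInt (hG : IsGaussianWhiteNoise G μ P) (c : FinMeasSet μ →₀ ℝ) :
    ∫ w, wienerInt G c w ∂P = 0 := by
  simp only [wienerInt, Finsupp.linearCombination_apply, Finsupp.sum]
  rw [integral_finsetSum]
  · refine Finset.sum_eq_zero fun A _ => ?_
    simp only [smul_eq_mul, integral_const_mul, hG.centred A.1 A.2.1 A.2.2, mul_zero]
  · exact fun A _ => ((hG.isGaussianProcess.hasGaussianLaw_eval A).integrable).const_mul _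

/-- The Wiener isometry for step functions. -/
lemma covariance_wienerInt (hG : IsGaussianWhiteNoise G μ P) (c d : FinMeasSet μ →₀ ℝ) :
    cov[wienerInt G c, wienerInt G d; P] = ∫ x, stepFun c x * stepFun d x ∂μ := by
  have := hG.isGaussianProcess.isProbabilityMeasure
  induction c using Finsupp.induction_linear with
  | zero =>
    have : wienerInt G (0 : FinMeasSet μ →₀ ℝ) = 0 := by ext w; simp [wienerInt]
    simp [this, stepFun]
  | add c₁ c₂ h₁ h₂ =>
    have e : wienerInt G (c₁ + c₂) = wienerInt G c₁ + wienerInt G c₂ := by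
      ext w; exact map_add _ _ _
    have e' : ∀ x, stepFun (c₁ + c₂) x = stepFun c₁ x + stepFun c₂ x := fun x => map_add _ _ _
    rw [e, covariance_add_left (hG.memLp_wienerInt _) (hG.memLp_wienerInt _)
      (hG.memLp_wienerInt _), h₁, h₂]
    simp_rw [e', add_mul]
    exact (integral_add ((memLp_stepFun c₁).integrable_mul (memLp_stepFun d))
      ((memLp_stepFun c₂).integrable_mul (memLp_stepFun d))).symm
  | single A a =>
    have e : wienerInt G (Finsupp.single A a) = fun w => a * G A.1 w := by
      ext w; exact wienerInt_single _ _ _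
    rw [e, covariance_const_mul_left]
    simp_rw [stepFun_single, mul_assoc]
    rw [integral_const_mul]
    congr 1
    have hA := (hG.isGaussianProcess.hasGaussianLaw_eval A).memLp_two
    have hi : MemLp (A.1.indicator (fun _ => (1 : ℝ))) 2 μ :=
      memLp_indicator_const 2 A.2.1 1 (Or.inr A.2.2.ne)
    induction d using Finsupp.induction_linear with
    | zero =>
      have : wienerInt G (0 : FinMeasSet μ →₀ ℝ) = 0 := by ext w; simp [wienerInt]
      simp [this, stepFun]
    | add d₁ d₂ h₁ h₂ =>
      have e : wienerInt G (d₁ + d₂) = wienerInt G d₁ + wienerInt G d₂ := by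
        ext w; exact map_add _ _ _
      have e' : ∀ x, stepFun (d₁ + d₂) x = stepFun d₁ x + stepFun d₂ x := fun x => map_add _ _ _
      rw [e, covariance_add_right hA (hG.memLp_wienerInt _) (hG.memLp_wienerInt _), h₁, h₂]
      simp_rw [e', mul_add]
      exact (integral_add (hi.integrable_mul (memLp_stepFun d₁))
        (hi.integrable_mul (memLp_stepFun d₂))).symm
    | single B b =>
      have e : wienerInt G (Finsupp.single B b) = fun w => b * G B.1 w := by
        ext w; exact wienerInt_single _ _ _
      rw [e, covariance_const_mul_right, hG.covariance A.1 B.1 A.2.1 A.2.2 B.2.1 B.2.2]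
      have e' : ∀ x, A.1.indicator (fun _ => (1 : ℝ)) x * stepFun (Finsupp.single B b) x
          = b * (A.1 ∩ B.1).indicator (fun _ => (1 : ℝ)) x := fun x => by
        rw [stepFun_single]
        by_cases h1 : x ∈ A.1 <;> by_cases h2 : x ∈ B.1 <;> simp [h1, h2]
      simp_rw [e']
      rw [integral_const_mul, integral_indicator_const _ (A.2.1.inter B.2.1)]
      simp [Measure.real]

/-- Stochastic integrals are Gaussian, so their moments are those of a standard Gaussian variable,
scaled by the `L²` norm of the integrand. -/
lemma lintegral_enorm_wienerInt_rpow (hG : IsGaussianWhiteNoise G μ P) (c : FinMeasSet μ →₀ ℝ)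
    {p : ℝ} (hp : 0 < p) :
    ∫⁻ w, ‖wienerInt G c w‖ₑ ^ p ∂P
      = (∫⁻ x, ‖stepFun c x‖ₑ ^ (2 : ℝ) ∂μ) ^ (p / 2) * gaussianMoment p := by
  have hm := hG.aemeasurable_wienerInt c
  set v : ℝ := ∫ x, stepFun c x * stepFun c x ∂μ with hv
  have hv0 : 0 ≤ v := integral_nonneg fun x => mul_self_nonneg _
  have hlaw := (hG.isGaussianProcess_wienerInt.hasGaussianLaw_eval c).map_eq_gaussianReal
  rw [hG.integral_wienerInt, ← covariance_self hm, hG.covariance_wienerInt, ← hv] at hlaw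
  have hscale : (gaussianReal 0 1).map (Real.sqrt v * ·) = gaussianReal 0 v.toNNReal := by
    rw [gaussianReal_map_const_mul, mul_zero, mul_one]
    congr 1
    ext
    simp [Real.sq_sqrt hv0, hv0]
  rw [lintegral_enorm_stepFun_sq c, ← hv]
  have hme : Measurable fun x : ℝ => ‖x‖ₑ ^ p := by fun_prop
  calc ∫⁻ w, ‖wienerInt G c w‖ₑ ^ p ∂P
      = ∫⁻ x, ‖x‖ₑ ^ p ∂(P.map (wienerInt G c)) := (lintegral_map' hme.aemeasurable hm).symm
    _ = ∫⁻ x, ‖Real.sqrt v * x‖ₑ ^ p ∂gaussianReal 0 1 := by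
        rw [hlaw, ← hscale, lintegral_map hme (by fun_prop)]
    _ = ∫⁻ x, ENNReal.ofReal v ^ (p / 2) * ‖x‖ₑ ^ p ∂gaussianReal 0 1 := by
        refine lintegral_congr fun x => ?_
        rw [enorm_mul, ENNReal.mul_rpow_of_nonneg _ _ hp.le]
        congr 1
        rw [Real.enorm_eq_ofReal (Real.sqrt_nonneg _), Real.sqrt_eq_rpow,
          ← ENNReal.ofReal_rpow_of_nonneg hv0 (by norm_num), ← ENNReal.rpow_mul]
        congr 1
        ring
    _ = _ := lintegral_const_mul _ hme

/-- Two step functions that agree have the same stochastic integral. -/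
lemma wienerInt_ae_eq (hG : IsGaussianWhiteNoise G μ P) {c d : FinMeasSet μ →₀ ℝ}
    (h : ∀ x, stepFun c x = stepFun d x) : wienerInt G c =ᵐ[P] wienerInt G d := by
  have h2 := hG.lintegral_enorm_wienerInt_rpow (c - d) (p := 2) (by norm_num)
  simp only [stepFun_sub, h, sub_self, enorm_zero] at h2
  norm_num at h2
  rw [lintegral_eq_zero_iff' (((hG.aemeasurable_wienerInt _).enorm).pow_const _)] at h2
  filter_upwards [h2] with w hw
  simpa [wienerInt_sub, sub_eq_zero] using hw

end IsGaussianWhiteNoise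

end Wiener

/-! ### Dyadic chaining -/

/-- The largest multiple of `2⁻ⁿ` that is at most `t`. -/
noncomputable def dyadicFloor (n : ℕ) (t : ℝ) : ℝ := (⌊2 ^ n * t⌋ : ℝ) / 2 ^ n

/-- The `ℓᵖ` norm of the increments of `f` over the dyadic intervals of length `2⁻ⁿ` that make up
`[-N, N)`. -/
noncomputable def dyadicOsc (p : ℝ) (f : ℝ → ℝ) (N n : ℕ) : ℝ≥0∞ :=
  (∑ k ∈ Finset.Ico (-(N * 2 ^ n) : ℤ) (N * 2 ^ n),
    edist (f (k / 2 ^ n)) (f ((k + 1) / 2 ^ n)) ^ p) ^ (1 / p)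

lemma dyadicFloor_le (n : ℕ) (t : ℝ) : dyadicFloor n t ≤ t := by
  rw [dyadicFloor, div_le_iff₀ (by positivity), mul_comm t]
  exact Int.floor_le _

lemma lt_dyadicFloor_add (n : ℕ) (t : ℝ) : t < dyadicFloor n t + (1 / 2) ^ n := by
  have h := Int.lt_floor_add_one (2 ^ n * t)
  have h2 : (0 : ℝ) < 2 ^ n := by positivity
  rw [dyadicFloor, one_div_pow, ← add_div, lt_div_iff₀ h2]
  linarith

lemma tendsto_dyadicFloor (t : ℝ) : Tendsto (fun n => dyadicFloor n t) atTop (𝓝 t) := by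
  have h : Tendsto (fun n : ℕ => t - (1 / 2 : ℝ) ^ n) atTop (𝓝 (t - 0)) :=
    tendsto_const_nhds.sub (tendsto_pow_atTop_nhds_zero_of_lt_one (by norm_num) (by norm_num))
  rw [sub_zero] at h
  exact tendsto_of_tendsto_of_tendsto_of_le_of_le h tendsto_const_nhds
    (fun n => by have := lt_dyadicFloor_add n t; dsimp only; linarith) (fun n => dyadicFloor_le n t)

lemma floor_mem_Ico {N : ℕ} (n : ℕ) {t : ℝ} (ht : t ∈ Ico (-N : ℝ) N) :
    ⌊2 ^ n * t⌋ ∈ Finset.Ico (-(N * 2 ^ n) : ℤ) (N * 2 ^ n) := by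
  have h2 : (0 : ℝ) < 2 ^ n := by positivity
  rw [Finset.mem_Ico, Int.le_floor, Int.floor_lt]
  push_cast
  constructor <;> nlinarith [ht.1, ht.2]

lemma edist_le_dyadicOsc {p : ℝ} (hp : 0 < p) (f : ℝ → ℝ) {N n : ℕ} {k : ℤ}
    (hk : k ∈ Finset.Ico (-(N * 2 ^ n) : ℤ) (N * 2 ^ n)) :
    edist (f (k / 2 ^ n)) (f ((k + 1) / 2 ^ n)) ≤ dyadicOsc p f N n := by
  rw [dyadicOsc, one_div, ENNReal.le_rpow_inv_iff hp]
  exact Finset.single_le_sum (f := fun k : ℤ => edist (f (k / 2 ^ n)) (f ((k + 1) / 2 ^ n)) ^ p)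
    (fun _ _ => zero_le) hk

lemma edist_dyadicFloor_succ_le {p : ℝ} (hp : 0 < p) (f : ℝ → ℝ) {N : ℕ} (n : ℕ) {t : ℝ}
    (ht : t ∈ Ico (-N : ℝ) N) :
    edist (f (dyadicFloor n t)) (f (dyadicFloor (n + 1) t)) ≤ dyadicOsc p f N (n + 1) := by
  have hb := Finset.mem_Ico.1 (floor_mem_Ico (n + 1) ht)
  have ha := Finset.mem_Ico.1 (floor_mem_Ico n ht)
  set a := ⌊2 ^ n * t⌋ with hadef
  set b := ⌊2 ^ (n + 1) * t⌋ with hbdef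
  have e : (2 : ℝ) ^ (n + 1) * t = 2 * (2 ^ n * t) := by ring
  have h1 : 2 * a ≤ b := by
    rw [hbdef, Int.le_floor, e]
    push_cast
    linarith [Int.floor_le (2 ^ n * t)]
  have h2 : b < 2 * a + 2 := by
    rw [hbdef, Int.floor_lt, e]
    push_cast
    linarith [Int.lt_floor_add_one (2 ^ n * t)]
  have ea : (a : ℝ) / 2 ^ n = ((2 * a : ℤ) : ℝ) / 2 ^ (n + 1) := by
    push_cast
    rw [pow_succ, mul_comm (2 ^ n : ℝ) 2, mul_div_mul_left _ _ two_ne_zero]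
  rw [dyadicFloor, dyadicFloor, ← hadef, ← hbdef, ea]
  obtain h | h : b = 2 * a ∨ b = 2 * a + 1 := by omega
  · rw [h, edist_self]
    exact zero_le
  · rw [h]
    push_cast
    have := edist_le_dyadicOsc hp f (N := N) (n := n + 1) (k := 2 * a)
      (Finset.mem_Ico.2 ⟨by rw [pow_succ]; linarith [ha.1], by linarith [hb.2]⟩)
    push_cast at this
    exact this

/-- Points at distance less than `2⁻ⁿ` lie in the same dyadic interval or in adjacent ones. -/
lemma edist_dyadicFloor_le_of_abs_sub_lt {p : ℝ} (hp : 0 < p) (f : ℝ → ℝ) {N : ℕ} (n : ℕ)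
    {s t : ℝ} (hs : s ∈ Ico (-N : ℝ) N) (ht : t ∈ Ico (-N : ℝ) N) (hst : |s - t| < (1 / 2) ^ n) :
    edist (f (dyadicFloor n s)) (f (dyadicFloor n t)) ≤ dyadicOsc p f N n := by
  wlog hle : s ≤ t generalizing s t
  · rw [edist_comm]
    exact this ht hs (by rwa [abs_sub_comm]) (le_of_not_ge hle)
  have ha := floor_mem_Ico n hs
  set a := ⌊2 ^ n * s⌋ with hadef
  set b := ⌊2 ^ n * t⌋ with hbdef
  have h2 : (0 : ℝ) < 2 ^ n := by positivity
  have h3 : 2 ^ n * t < 2 ^ n * s + 1 := by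
    rw [abs_sub_comm, abs_of_nonneg (by linarith), one_div_pow, lt_div_iff₀ h2] at hst
    linarith
  have h1 : a ≤ b := Int.floor_mono (by gcongr)
  have h4 : b < a + 2 := by
    rw [hbdef, Int.floor_lt]
    push_cast
    linarith [Int.lt_floor_add_one (2 ^ n * s)]
  rw [dyadicFloor, dyadicFloor, ← hadef, ← hbdef]
  obtain h | h : b = a ∨ b = a + 1 := by omega
  · rw [h, edist_self]
    exact zero_le
  · rw [h]
    push_cast
    exact edist_le_dyadicOsc hp f ha

section Deterministic

variable {p : ℝ} {f : ℝ → ℝ} {N : ℕ}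

lemma tendsto_limUnder_dyadicFloor (hp : 0 < p) (hN : ∑' n, dyadicOsc p f N n ≠ ∞) {t : ℝ}
    (ht : t ∈ Ico (-N : ℝ) N) :
    Tendsto (fun n => f (dyadicFloor n t)) atTop
      (𝓝 (limUnder atTop fun n => f (dyadicFloor n t))) := by
  refine CauchySeq.tendsto_limUnder (cauchySeq_of_edist_le_of_tsum_ne_top
    (fun n => dyadicOsc p f N (n + 1)) (fun n => edist_dyadicFloor_succ_le hp f n ht) ?_)
  exact ((ENNReal.tsum_comp_le_tsum_of_injective (add_left_injective 1) _).trans_lt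
    hN.lt_top).ne

lemma edist_limUnder_dyadicFloor_le (hp : 0 < p) (hN : ∑' n, dyadicOsc p f N n ≠ ∞) {t : ℝ}
    (ht : t ∈ Ico (-N : ℝ) N) (n : ℕ) :
    edist (f (dyadicFloor n t)) (limUnder atTop fun n => f (dyadicFloor n t))
      ≤ ∑' m, dyadicOsc p f N (m + n) := by
  refine (edist_le_tsum_of_edist_le_of_tendsto (fun n => dyadicOsc p f N (n + 1))
    (fun n => edist_dyadicFloor_succ_le hp f n ht) (tendsto_limUnder_dyadicFloor hp hN ht)
    n).trans ?_
  have : ∀ m, dyadicOsc p f N (n + m + 1) = (fun m => dyadicOsc p f N (m + n)) (m + 1) :=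
    fun m => by
      dsimp only
      congr 1
      omega
  simp_rw [this]
  exact ENNReal.tsum_comp_le_tsum_of_injective (add_left_injective 1) _

lemma continuous_limUnder_dyadicFloor (hp : 0 < p)
    (h : ∀ N : ℕ, ∑' n, dyadicOsc p f N n ≠ ∞) :
    Continuous fun t => limUnder atTop fun n => f (dyadicFloor n t) := by
  refine continuous_iff_continuousAt.2 fun t => ?_
  obtain ⟨N, hN⟩ := exists_nat_gt (|t| + 1)
  have hIoo : ∀ s, |s - t| < 1 → s ∈ Ico (-N : ℝ) N := fun s hs => by
    have h1 := abs_lt.1 hs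
    have h2 := neg_abs_le t
    have h3 := le_abs_self t
    exact ⟨by linarith, by linarith⟩
  have ht : t ∈ Ico (-N : ℝ) N := hIoo t (by simp)
  have hsmall : Tendsto (fun n => ∑' m, dyadicOsc p f N (m + n)) atTop (𝓝 0) :=
    ENNReal.tendsto_sum_nat_add _ (h N)
  refine EMetric.tendsto_nhds.2 fun ε hε => ?_
  have hε3 : (0 : ℝ≥0∞) < ε / 3 := ENNReal.div_pos hε.ne' (by norm_num)
  obtain ⟨n, hn⟩ := (hsmall.eventually_lt_const hε3).exists
  have hosc : dyadicOsc p f N n ≤ ∑' m, dyadicOsc p f N (m + n) := by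
    simpa using ENNReal.le_tsum (f := fun m => dyadicOsc p f N (m + n)) 0
  filter_upwards [Metric.ball_mem_nhds t (show (0 : ℝ) < (1 / 2) ^ n by positivity)] with s hs
  rw [Metric.mem_ball, Real.dist_eq] at hs
  have hs' : s ∈ Ico (-N : ℝ) N :=
    hIoo s (hs.trans_le (pow_le_one₀ (by norm_num) (by norm_num)))
  calc _ ≤ edist _ (f (dyadicFloor n s)) + edist (f (dyadicFloor n s)) (f (dyadicFloor n t))
        + edist (f (dyadicFloor n t)) _ := edist_triangle4 _ _ _ _
    _ < ε / 3 + ε / 3 + ε / 3 := by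
      refine ENNReal.add_lt_add (ENNReal.add_lt_add ?_ ?_) ?_
      · rw [edist_comm]
        exact (edist_limUnder_dyadicFloor_le hp (h N) hs' n).trans_lt hn
      · exact ((edist_dyadicFloor_le_of_abs_sub_lt hp f n hs' ht hs).trans hosc).trans_lt hn
      · exact (edist_limUnder_dyadicFloor_le hp (h N) ht n).trans_lt hn
    _ = ε := ENNReal.add_thirds ε

lemma edist_zero_le_tsum_dyadicOsc (hp : 0 < p) (hf : Continuous f) {t : ℝ}
    (ht : t ∈ Ico (0 : ℝ) N) :
    edist (f t) (f 0) ≤ (N + 1) * ∑' n, dyadicOsc p f N n := by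
  have ht' : t ∈ Ico (-N : ℝ) N := ⟨by linarith [ht.1, (Nat.cast_nonneg N : (0 : ℝ) ≤ N)], ht.2⟩
  have h1 : edist (f (dyadicFloor 0 t)) (f t) ≤ ∑' n, dyadicOsc p f N (n + 1) :=
    edist_le_tsum_of_edist_le_of_tendsto₀ (fun n => dyadicOsc p f N (n + 1))
      (fun n => edist_dyadicFloor_succ_le hp f n ht')
      ((hf.tendsto t).comp (tendsto_dyadicFloor t))
  have h2 : edist (f 0) (f (dyadicFloor 0 t)) ≤ N * dyadicOsc p f N 0 := by
    have hfl : dyadicFloor 0 t = (⌊t⌋₊ : ℝ) := by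
      simp [dyadicFloor, natCast_floor_eq_intCast_floor ht.1]
    have hlt : ⌊t⌋₊ < N := (Nat.floor_lt ht.1).2 ht.2
    rw [hfl]
    calc edist (f 0) (f (⌊t⌋₊ : ℝ))
        ≤ ∑ i ∈ Finset.range ⌊t⌋₊, edist (f (i : ℝ)) (f ((i + 1 : ℕ) : ℝ)) := by
          simpa using edist_le_range_sum_edist (fun i : ℕ => f (i : ℝ)) ⌊t⌋₊
      _ ≤ ∑ i ∈ Finset.range ⌊t⌋₊, dyadicOsc p f N 0 := by
          refine Finset.sum_le_sum fun i hi => ?_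
          have hi' := Finset.mem_range.1 hi
          have := edist_le_dyadicOsc hp f (N := N) (n := 0) (k := i)
            (Finset.mem_Ico.2 ⟨by omega, by simp; omega⟩)
          simpa using this
      _ ≤ N * dyadicOsc p f N 0 := by
          rw [Finset.sum_const, Finset.card_range, nsmul_eq_mul]
          gcongr
  calc edist (f t) (f 0) ≤ N * dyadicOsc p f N 0 + ∑' n, dyadicOsc p f N (n + 1) := by
        rw [edist_comm]
        exact (edist_triangle _ _ _).trans (add_le_add h2 h1)
    _ ≤ N * ∑' n, dyadicOsc p f N n + ∑' n, dyadicOsc p f N n := by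
        refine add_le_add (mul_le_mul_right (ENNReal.le_tsum 0) _) ?_
        exact ENNReal.tsum_comp_le_tsum_of_injective (add_left_injective 1) _
    _ = _ := by ring

end Deterministic

section KolmogorovCondition

variable {Ω : Type*} [MeasurableSpace Ω] {P : Measure Ω} {Z : ℝ → Ω → ℝ} {K : ℝ≥0∞} {p q : ℝ}

lemma aemeasurable_dyadicOsc (hZ : ∀ t, AEMeasurable (Z t) P) (N n : ℕ) :
    AEMeasurable (fun w => dyadicOsc p (fun t => Z t w) N n) P := by
  unfold dyadicOsc
  refine AEMeasurable.pow_const (Finset.aemeasurable_fun_sum _ fun k _ => ?_) _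
  exact ((hZ _).edist (hZ _)).pow_const _

/-- The `ℓᵖ` norm over the `2N · 2ⁿ` dyadic intervals of length `2⁻ⁿ` costs a factor `2^(n/p)`,
which the moment bound of order `2^(-nq/p)` beats as soon as `q > 1`. -/
lemma lintegral_dyadicOsc_le [IsProbabilityMeasure P] (hp : 1 ≤ p)
    (hm : ∀ t, AEMeasurable (Z t) P)
    (hZ : ∀ s t, ∫⁻ w, edist (Z s w) (Z t w) ^ p ∂P ≤ K * ENNReal.ofReal |t - s| ^ q)
    (N n : ℕ) :
    ∫⁻ w, dyadicOsc p (fun t => Z t w) N n ∂P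
      ≤ (2 * N * K) ^ (1 / p) * (((2 : ℝ≥0∞) ^ (1 - q)) ^ (1 / p)) ^ n := by
  have hp0 : 0 < p := by linarith
  have hosc := aemeasurable_dyadicOsc (p := p) hm N n
  have hjensen := eLpNorm'_le_eLpNorm'_of_exponent_le zero_lt_one hp P hosc.aestronglyMeasurable
  simp only [eLpNorm'_eq_lintegral_enorm, enorm_eq_self, ENNReal.rpow_one, div_one] at hjensen
  refine hjensen.trans ?_
  have hpow : ∀ w, dyadicOsc p (fun t => Z t w) N n ^ p
      = ∑ k ∈ Finset.Ico (-(N * 2 ^ n) : ℤ) (N * 2 ^ n),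
          edist (Z (k / 2 ^ n) w) (Z ((k + 1) / 2 ^ n) w) ^ p := fun w => by
    rw [dyadicOsc, ← ENNReal.rpow_mul, one_div_mul_cancel hp0.ne', ENNReal.rpow_one]
  have hcard : ((Finset.Ico (-(N * 2 ^ n) : ℤ) (N * 2 ^ n)).card : ℝ≥0∞) = 2 * N * 2 ^ n := by
    have : (Finset.Ico (-(N * 2 ^ n) : ℤ) (N * 2 ^ n)).card = 2 * N * 2 ^ n := by
      rw [Int.card_Ico]
      zify
      have h0 : (0 : ℤ) ≤ N * 2 ^ n := by positivity
      rw [Int.toNat_of_nonneg (by linarith)]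
      ring
    rw [this]
    push_cast
    ring
  have hscale : (2 : ℝ≥0∞) ^ n * ENNReal.ofReal ((1 / 2) ^ n) ^ q = (2 ^ (1 - q)) ^ n := by
    have e1 : ENNReal.ofReal ((1 / 2) ^ n) = (2 : ℝ≥0∞) ^ (-(n : ℝ)) := by
      rw [ENNReal.rpow_neg, ENNReal.rpow_natCast, one_div, inv_pow,
        ENNReal.ofReal_inv_of_pos (by positivity), ENNReal.ofReal_pow (by norm_num)]
      norm_num
    rw [e1, ← ENNReal.rpow_natCast, ← ENNReal.rpow_natCast, ← ENNReal.rpow_mul,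
      ← ENNReal.rpow_mul, ← ENNReal.rpow_add _ _ (by norm_num) (by norm_num)]
    congr 1
    ring
  have hsum : ∫⁻ w, dyadicOsc p (fun t => Z t w) N n ^ p ∂P
      ≤ (2 * N * K) * ((2 : ℝ≥0∞) ^ (1 - q)) ^ n := by
    simp_rw [hpow]
    rw [lintegral_finsetSum' _ fun k _ => ((hm _).edist (hm _)).pow_const _]
    calc _ ≤ ∑ k ∈ Finset.Ico (-(N * 2 ^ n) : ℤ) (N * 2 ^ n),
          K * ENNReal.ofReal ((1 / 2) ^ n) ^ q := by
          refine Finset.sum_le_sum fun k _ => (hZ _ _).trans_eq ?_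
          congr 3
          rw [← sub_div, add_sub_cancel_left, one_div_pow, abs_of_pos (by positivity)]
      _ = _ := by
          rw [Finset.sum_const, nsmul_eq_mul, hcard, ← hscale]
          ring
  calc _ ≤ ((2 * N * K) * ((2 : ℝ≥0∞) ^ (1 - q)) ^ n) ^ (1 / p) := by gcongr
    _ = _ := by
      rw [ENNReal.mul_rpow_of_nonneg _ _ (by positivity)]
      congr 1
      simp only [← ENNReal.rpow_natCast, ← ENNReal.rpow_mul]
      congr 1
      ring

/-- The sum of the geometric series that arises in the chaining argument. -/
noncomputable def chainingConst (p q : ℝ) : ℝ≥0∞ := (1 - ((2 : ℝ≥0∞) ^ (1 - q)) ^ (1 / p))⁻¹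

lemma chainingConst_ne_top (hp : 0 < p) (hq : 1 < q) : chainingConst p q ≠ ∞ := by
  rw [chainingConst, ENNReal.inv_ne_top]
  refine (tsub_pos_of_lt (ENNReal.rpow_lt_one ?_ (by positivity))).ne'
  exact ENNReal.rpow_lt_one_of_one_lt_of_neg (by norm_num) (by linarith)

lemma lintegral_tsum_dyadicOsc_le [IsProbabilityMeasure P] (hp : 1 ≤ p)
    (hm : ∀ t, AEMeasurable (Z t) P)
    (hZ : ∀ s t, ∫⁻ w, edist (Z s w) (Z t w) ^ p ∂P ≤ K * ENNReal.ofReal |t - s| ^ q) (N : ℕ) :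
    ∫⁻ w, ∑' n, dyadicOsc p (fun t => Z t w) N n ∂P
      ≤ (2 * N * K) ^ (1 / p) * chainingConst p q := by
  rw [lintegral_tsum fun n => aemeasurable_dyadicOsc hm N n]
  refine (ENNReal.tsum_le_tsum fun n => lintegral_dyadicOsc_le hp hm hZ N n).trans_eq ?_
  rw [ENNReal.tsum_mul_left, ENNReal.tsum_geometric, chainingConst]

/-- A quantitative maximal inequality for continuous processes under Kolmogorov's condition. -/
lemma lintegral_iSup_edist_le [IsProbabilityMeasure P] (hp : 1 ≤ p)
    (hm : ∀ t, AEMeasurable (Z t) P) (hc : ∀ᵐ w ∂P, Continuous fun t => Z t w)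
    (hZ : ∀ s t, ∫⁻ w, edist (Z s w) (Z t w) ^ p ∂P ≤ K * ENNReal.ofReal |t - s| ^ q) (N : ℕ) :
    ∫⁻ w, ⨆ t ∈ Ico (0 : ℝ) N, edist (Z t w) (Z 0 w) ∂P
      ≤ (N + 1) * ((2 * N * K) ^ (1 / p) * chainingConst p q) := by
  calc _ ≤ ∫⁻ w, (N + 1) * ∑' n, dyadicOsc p (fun t => Z t w) N n ∂P := by
        refine lintegral_mono_ae ?_
        filter_upwards [hc] with w hw
        exact iSup₂_le fun t ht => edist_zero_le_tsum_dyadicOsc (by linarith) hw ht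
    _ = (N + 1) * ∫⁻ w, ∑' n, dyadicOsc p (fun t => Z t w) N n ∂P :=
        lintegral_const_mul' _ _ (by finiteness)
    _ ≤ _ := by gcongr; exact lintegral_tsum_dyadicOsc_le hp hm hZ N

/-- Under Kolmogorov's condition a process converges along the dyadic approximations of each
fixed time. -/
lemma ae_tendsto_dyadicFloor (hp : 0 < p) (hq : 1 < q) (hK : K ≠ ∞)
    (hm : ∀ t, AEMeasurable (Z t) P)
    (hZ : ∀ s t, ∫⁻ w, edist (Z s w) (Z t w) ^ p ∂P ≤ K * ENNReal.ofReal |t - s| ^ q) (t : ℝ) :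
    ∀ᵐ w ∂P, Tendsto (fun n => Z (dyadicFloor n t) w) atTop (𝓝 (Z t w)) := by
  have hmeas : ∀ n, AEMeasurable (fun w => edist (Z (dyadicFloor n t) w) (Z t w) ^ p) P :=
    fun n => ((hm _).edist (hm _)).pow_const _
  have hfin : ∫⁻ w, ∑' n, edist (Z (dyadicFloor n t) w) (Z t w) ^ p ∂P ≠ ∞ := by
    rw [lintegral_tsum hmeas]
    have hbound : ∀ n, ∫⁻ w, edist (Z (dyadicFloor n t) w) (Z t w) ^ p ∂P
        ≤ K * ENNReal.ofReal (1 / 2) ^ n := fun n => by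
      refine (hZ _ _).trans ?_
      gcongr
      have h1 := dyadicFloor_le n t
      have h2 := lt_dyadicFloor_add n t
      have h3 : |t - dyadicFloor n t| ≤ (1 / 2) ^ n := by
        rw [abs_of_nonneg (by linarith)]
        linarith
      have h4 : ENNReal.ofReal |t - dyadicFloor n t| ≤ ENNReal.ofReal (1 / 2) ^ n := by
        rw [← ENNReal.ofReal_pow (by norm_num)]
        exact ENNReal.ofReal_le_ofReal h3
      calc ENNReal.ofReal |t - dyadicFloor n t| ^ q
          ≤ ENNReal.ofReal |t - dyadicFloor n t| ^ (1 : ℝ) := by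
            refine ENNReal.rpow_le_rpow_of_exponent_ge (h4.trans (pow_le_one₀ zero_le ?_)) hq.le
            exact ENNReal.ofReal_le_one.2 (by norm_num)
        _ ≤ _ := by rwa [ENNReal.rpow_one]
    refine ne_top_of_le_ne_top ?_ (ENNReal.tsum_le_tsum hbound)
    rw [ENNReal.tsum_mul_left, ENNReal.tsum_geometric]
    refine ENNReal.mul_ne_top hK (ENNReal.inv_ne_top.2 (tsub_pos_of_lt ?_).ne')
    exact ENNReal.ofReal_lt_one.2 (by norm_num)
  filter_upwards [ae_lt_top' (AEMeasurable.tsum hmeas) hfin] with w hw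
  have h0 := ENNReal.tendsto_atTop_zero_of_tsum_ne_top hw.ne
  have h1 := h0.ennrpow_const (1 / p)
  simp only [← ENNReal.rpow_mul, mul_one_div_cancel hp.ne', ENNReal.rpow_one,
    ENNReal.zero_rpow_of_pos (one_div_pos.2 hp)] at h1
  exact tendsto_iff_edist_tendsto_0.2 h1

/-- The Kolmogorov–Chentsov theorem on `ℝ`: under Kolmogorov's condition there is a modification
with almost surely continuous paths. -/
lemma exists_continuous_modification [IsProbabilityMeasure P] (hp : 1 ≤ p) (hq : 1 < q)
    (hK : K ≠ ∞) (hm : ∀ t, AEMeasurable (Z t) P)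
    (hZ : ∀ s t, ∫⁻ w, edist (Z s w) (Z t w) ^ p ∂P ≤ K * ENNReal.ofReal |t - s| ^ q) :
    ∃ Y : ℝ → Ω → ℝ, (∀ t, Y t =ᵐ[P] Z t) ∧ ∀ᵐ w ∂P, Continuous fun t => Y t w := by
  have hp0 : 0 < p := by linarith
  refine ⟨fun t w => limUnder atTop fun n => Z (dyadicFloor n t) w, fun t => ?_, ?_⟩
  · filter_upwards [ae_tendsto_dyadicFloor hp0 hq hK hm hZ t] with w hw
    exact hw.limUnder_eq
  · have hfin : ∀ᵐ w ∂P, ∀ N : ℕ, ∑' n, dyadicOsc p (fun t => Z t w) N n ≠ ∞ := by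
      refine ae_all_iff.2 fun N => ?_
      have h : ∫⁻ w, ∑' n, dyadicOsc p (fun t => Z t w) N n ∂P ≠ ∞ := by
        refine ne_top_of_le_ne_top ?_ (lintegral_tsum_dyadicOsc_le hp hm hZ N)
        refine ENNReal.mul_ne_top (ENNReal.rpow_ne_top_of_nonneg (by positivity) ?_)
          (chainingConst_ne_top hp0 hq)
        exact ENNReal.mul_ne_top (by finiteness) hK
      filter_upwards [ae_lt_top' (AEMeasurable.tsum fun n =>
        aemeasurable_dyadicOsc hm N n) h] with w hw using hw.ne
    filter_upwards [hfin] with w hw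
    exact continuous_limUnder_dyadicFloor (f := fun t => Z t w) hp0 hw

end KolmogorovCondition

section Cones

/-! ### Slices of the cones -/

/-- The indicator function of the interval of centre `t` and radius `r`. -/
noncomputable def ballInd (r t x : ℝ) : ℝ := (Ioo (t - r) (t + r)).indicator (fun _ => 1) x

lemma measurable_ballInd (r t : ℝ) : Measurable (ballInd r t) :=
  measurable_const.indicator measurableSet_Ioo

lemma enorm_indicator_sub_sq {S : Type*} (A B : Set S) (x : S) :
    ‖A.indicator (fun _ => (1 : ℝ)) x - B.indicator (fun _ => (1 : ℝ)) x‖ₑ ^ (2 : ℝ)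
      = (A \ B).indicator 1 x + (B \ A).indicator 1 x := by
  by_cases hA : x ∈ A <;> by_cases hB : x ∈ B <;> simp [hA, hB]

/-- Two intervals of the same radius `r` have a symmetric difference of measure
`2 min (2r, |t - s|)`. -/
lemma lintegral_ballInd_sub_sq (r s t : ℝ) :
    ∫⁻ x, ‖ballInd r t x - ballInd r s x‖ₑ ^ (2 : ℝ)
      = 2 * ENNReal.ofReal (min (2 * r) |t - s|) := by
  have hvol : ∀ a b : ℝ, volume (Ioo (a - r) (a + r) \ Ioo (b - r) (b + r))
      = ENNReal.ofReal (min (2 * r) |a - b|) := fun a b => by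
    have hle : volume (Ioo (a - r) (a + r) ∩ Ioo (b - r) (b + r)) ≠ ∞ :=
      ((measure_mono inter_subset_left).trans_lt measure_Ioo_lt_top).ne
    rw [← sdiff_self_inter, measure_sdiff inter_subset_left
      (measurableSet_Ioo.inter measurableSet_Ioo).nullMeasurableSet hle, Ioo_inter_Ioo,
      Real.volume_Ioo, Real.volume_Ioo]
    have e : (a + r) ⊓ (b + r) - (a - r) ⊔ (b - r) = 2 * r - |a - b| := by
      rcases le_total a b with h | h
      · rw [inf_eq_left.2 (by linarith), sup_eq_right.2 (by linarith), abs_of_nonpos (by linarith)]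
        ring
      · rw [inf_eq_right.2 (by linarith), sup_eq_left.2 (by linarith), abs_of_nonneg (by linarith)]
        ring
    rw [e]
    rcases le_total (2 * r) |a - b| with h | h
    · rw [min_eq_left h, ENNReal.ofReal_of_nonpos (by linarith : 2 * r - |a - b| ≤ 0), tsub_zero]
      congr 1
      ring
    · rw [min_eq_right h, ← ENNReal.ofReal_sub _ (by linarith)]
      congr 1
      ring
  simp only [ballInd, enorm_indicator_sub_sq]
  rw [lintegral_add_left (measurable_one.indicator (measurableSet_Ioo.diff measurableSet_Ioo)),
    lintegral_indicator_one (measurableSet_Ioo.diff measurableSet_Ioo),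
    lintegral_indicator_one (measurableSet_Ioo.diff measurableSet_Ioo), hvol, hvol,
    abs_sub_comm s t, ← two_mul]

/-! ### The control measure -/

lemma lintegral_controlMeasure (H lam : ℝ) {φ : ℝ × ℝ → ℝ≥0∞} (hφ : Measurable φ) :
    ∫⁻ z, φ z ∂controlMeasure H lam
      = ∫⁻ h in Ioi 0, ENNReal.ofReal (lam ^ 2 * h ^ (2 * H - 2)) * ∫⁻ x, φ (x, h) := by
  have hw : Measurable fun z : ℝ × ℝ => ENNReal.ofReal (lam ^ 2 * z.2 ^ (2 * H - 2)) := by fun_prop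
  have hset : {p : ℝ × ℝ | 0 < p.2} = univ ×ˢ Ioi 0 := by ext; simp
  rw [controlMeasure, lintegral_withDensity_eq_lintegral_mul _ hw hφ, hset,
    Measure.volume_eq_prod, ← Measure.prod_restrict, Measure.restrict_univ,
    lintegral_prod_symm' _ (hw.mul hφ)]
  refine lintegral_congr fun h => ?_
  simp only [Pi.mul_apply]
  exact lintegral_const_mul _ (by fun_prop)

variable {H lam : ℝ}

lemma lintegral_Ioi_weight (hH : H < 1 / 2) {T : ℝ} (hT : 0 < T) :
    ∫⁻ h in Ioi T, ENNReal.ofReal (lam ^ 2 * h ^ (2 * H - 2))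
      = ENNReal.ofReal (lam ^ 2 * (T ^ (2 * H - 1) / (1 - 2 * H))) := by
  have ha : 2 * H - 2 < -1 := by linarith
  rw [← ofReal_integral_eq_lintegral_ofReal ((integrableOn_Ioi_rpow_of_lt ha hT).const_mul _)
    ((ae_restrict_iff' measurableSet_Ioi).2 (Eventually.of_forall fun h hh => ?_))]
  · rw [integral_const_mul, integral_Ioi_rpow_of_lt ha hT]
    congr 2
    rw [show 2 * H - 2 + 1 = 2 * H - 1 by ring, ← neg_div_neg_eq]
    congr 1 <;> ring
  · have : 0 < h := hT.trans hh
    positivity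

/-- Both `∫_0^τ h^(2H-1) dh` and `τ ∫_τ^∞ h^(2H-2) dh` are multiples of `τ^(2H)`; this is where
`0 < H < 1/2` is needed. -/
lemma lintegral_weight_min (hH0 : 0 < H) (hH : H < 1 / 2) {τ : ℝ} (hτ : 0 ≤ τ) :
    ∫⁻ h in Ioi 0, ENNReal.ofReal (lam ^ 2 * h ^ (2 * H - 2)) * ENNReal.ofReal (min h τ)
      = ENNReal.ofReal (lam ^ 2 / (2 * H * (1 - 2 * H)) * τ ^ (2 * H)) := by
  rcases hτ.eq_or_lt with rfl | hτ
  · rw [Real.zero_rpow (by positivity), mul_zero, ENNReal.ofReal_zero,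
      setLIntegral_congr_fun (g := 0) measurableSet_Ioi]
    · simp
    · intro h hh
      simp [min_eq_right (le_of_lt (mem_Ioi.1 hh))]
  have h12 : 0 < 1 - 2 * H := by linarith
  rw [← Ioc_union_Ioi_eq_Ioi hτ.le, lintegral_union measurableSet_Ioi Ioc_disjoint_Ioi_same]
  have h1 : ∫⁻ h in Ioc 0 τ, ENNReal.ofReal (lam ^ 2 * h ^ (2 * H - 2)) * ENNReal.ofReal (min h τ)
      = ENNReal.ofReal (lam ^ 2 * (τ ^ (2 * H) / (2 * H))) := by
    have hi : IntegrableOn (fun h : ℝ => h ^ (2 * H - 1)) (Ioc 0 τ) :=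
      (intervalIntegrable_iff_integrableOn_Ioc_of_le hτ.le).1
        (intervalIntegral.intervalIntegrable_rpow' (by linarith))
    rw [setLIntegral_congr_fun (g := fun h => ENNReal.ofReal (lam ^ 2 * h ^ (2 * H - 1)))
      measurableSet_Ioc]
    · rw [← ofReal_integral_eq_lintegral_ofReal (hi.const_mul _)
        ((ae_restrict_iff' measurableSet_Ioc).2 (Eventually.of_forall fun h hh => ?_))]
      · rw [integral_const_mul, ← intervalIntegral.integral_of_le hτ.le,
          integral_rpow (Or.inl (by linarith))]
        congr 2
        rw [sub_add_cancel, Real.zero_rpow (by positivity), sub_zero]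
      · have : 0 < h := hh.1
        positivity
    · intro h hh
      have h0 : 0 < h := hh.1
      dsimp only
      rw [min_eq_left hh.2, ← ENNReal.ofReal_mul (by positivity), mul_assoc]
      congr 2
      rw [← Real.rpow_add_one h0.ne']
      congr 1
      ring
  have h2 : ∫⁻ h in Ioi τ, ENNReal.ofReal (lam ^ 2 * h ^ (2 * H - 2)) * ENNReal.ofReal (min h τ)
      = ENNReal.ofReal (lam ^ 2 * (τ ^ (2 * H) / (1 - 2 * H))) := by
    rw [setLIntegral_congr_fun (g := fun h => ENNReal.ofReal (lam ^ 2 * h ^ (2 * H - 2)) *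
      ENNReal.ofReal τ) measurableSet_Ioi fun h hh => by
        dsimp only; rw [min_eq_right (le_of_lt (mem_Ioi.1 hh))]]
    rw [lintegral_mul_const _ (by fun_prop), lintegral_Ioi_weight hH hτ,
      ← ENNReal.ofReal_mul (by positivity), mul_assoc, div_mul_eq_mul_div,
      ← Real.rpow_add_one hτ.ne', sub_add_cancel]
  rw [h1, h2, ← ENNReal.ofReal_add (by positivity) (by positivity)]
  congr 1
  field_simp
  ring

/-! ### The cones -/

lemma measurableSet_cone (t : ℝ) : MeasurableSet (cone t) :=
  (measurableSet_lt measurable_const measurable_snd).inter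
    (measurableSet_lt (f := fun p : ℝ × ℝ => |p.1 - t|) (g := fun p => p.2 / 2)
      (by fun_prop) (by fun_prop))

lemma measurable_indicator_cone (t : ℝ) :
    Measurable ((cone t).indicator fun _ => (1 : ℝ)) :=
  measurable_const.indicator (measurableSet_cone t)

lemma measurableSet_truncCone (T t : ℝ) : MeasurableSet (truncCone T t) :=
  (measurableSet_lt measurable_const measurable_snd).inter
    (measurableSet_lt (f := fun p : ℝ × ℝ => |p.1 - t|) (g := fun p => min p.2 T / 2)
      (by fun_prop) (by fun_prop))

lemma measurable_indicator_truncCone (T t : ℝ) :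
    Measurable ((truncCone T t).indicator fun _ => (1 : ℝ)) :=
  measurable_const.indicator (measurableSet_truncCone T t)

lemma indicator_cone {h : ℝ} (hh : 0 < h) (t x : ℝ) :
    (cone t).indicator (fun _ => (1 : ℝ)) (x, h) = ballInd (h / 2) t x := by
  simp only [ballInd, indicator, cone, mem_ofPred_eq, hh, true_and, mem_Ioo, abs_lt]
  congr 1
  exact propext ⟨fun h => ⟨by linarith, by linarith⟩, fun h => ⟨by linarith, by linarith⟩⟩

lemma indicator_truncCone {h : ℝ} (hh : 0 < h) (T t x : ℝ) :
    (truncCone T t).indicator (fun _ => (1 : ℝ)) (x, h) = ballInd (min h T / 2) t x := by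
  simp only [ballInd, indicator, truncCone, mem_ofPred_eq, hh, true_and, mem_Ioo, abs_lt]
  congr 1
  exact propext ⟨fun h => ⟨by linarith, by linarith⟩, fun h => ⟨by linarith, by linarith⟩⟩

lemma controlMeasure_truncCone_lt_top (hH0 : 0 < H) (hH : H < 1 / 2) {T : ℝ} (hT : 0 < T)
    (t : ℝ) : controlMeasure H lam (truncCone T t) < ∞ := by
  have hmeas := measurableSet_truncCone T t
  rw [← lintegral_indicator_one hmeas,
    lintegral_controlMeasure H lam (measurable_one.indicator hmeas),
    setLIntegral_congr_fun (g := fun h => ENNReal.ofReal (lam ^ 2 * h ^ (2 * H - 2)) *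
      ENNReal.ofReal (min h T)) measurableSet_Ioi, lintegral_weight_min hH0 hH hT.le]
  · exact ENNReal.ofReal_lt_top
  · intro h hh
    have h0 : 0 < h := hh
    dsimp only
    congr 1
    have e : ∀ x, (truncCone T t).indicator (1 : ℝ × ℝ → ℝ≥0∞) (x, h)
        = (Ioo (t - min h T / 2) (t + min h T / 2)).indicator 1 x := fun x => by
      simp only [indicator, truncCone, mem_ofPred_eq, h0, true_and, mem_Ioo, abs_lt, Pi.one_apply]
      congr 1
      exact propext ⟨fun h => ⟨by linarith, by linarith⟩, fun h => ⟨by linarith, by linarith⟩⟩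
    simp_rw [e]
    rw [lintegral_indicator_one measurableSet_Ioo, Real.volume_Ioo]
    congr 1
    ring

/-- The squared `L²` distance between the indicators of two full cones. -/
lemma lintegral_cone_sub_sq (hH0 : 0 < H) (hH : H < 1 / 2) (s t : ℝ) :
    ∫⁻ z, ‖(cone t).indicator (fun _ => (1 : ℝ)) z - (cone s).indicator (fun _ => (1 : ℝ)) z‖ₑ
        ^ (2 : ℝ) ∂controlMeasure H lam
      = ENNReal.ofReal (lam ^ 2 / (H * (1 - 2 * H)) * |t - s| ^ (2 * H)) := by
  have hc := measurable_indicator_cone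
  rw [lintegral_controlMeasure H lam (((hc t).fun_sub (hc s)).enorm.pow_const _),
    setLIntegral_congr_fun (g := fun h => 2 * (ENNReal.ofReal (lam ^ 2 * h ^ (2 * H - 2)) *
      ENNReal.ofReal (min h |t - s|))) measurableSet_Ioi,
    lintegral_const_mul _ (by fun_prop), lintegral_weight_min hH0 hH (abs_nonneg _)]
  · have h12 : 0 < 1 - 2 * H := by linarith
    rw [← ENNReal.ofReal_ofNat, ← ENNReal.ofReal_mul (by norm_num)]
    congr 1
    field_simp
  · intro h hh
    have h0 : 0 < h := hh
    simp only [indicator_cone h0]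
    rw [lintegral_ballInd_sub_sq, mul_div_cancel₀ _ (two_ne_zero)]
    ring

/-- Truncation only decreases the radii, hence the distance between indicators. -/
lemma lintegral_truncCone_sub_sq_le (hH0 : 0 < H) (hH : H < 1 / 2) (T s t : ℝ) :
    ∫⁻ z, ‖(truncCone T t).indicator (fun _ => (1 : ℝ)) z
        - (truncCone T s).indicator (fun _ => (1 : ℝ)) z‖ₑ ^ (2 : ℝ) ∂controlMeasure H lam
      ≤ ENNReal.ofReal (lam ^ 2 / (H * (1 - 2 * H)) * |t - s| ^ (2 * H)) := by
  have hc := measurable_indicator_cone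
  have hc' := measurable_indicator_truncCone T
  rw [← lintegral_cone_sub_sq hH0 hH s t,
    lintegral_controlMeasure H lam (((hc t).fun_sub (hc s)).enorm.pow_const _),
    lintegral_controlMeasure H lam (((hc' t).fun_sub (hc' s)).enorm.pow_const _)]
  refine setLIntegral_mono' measurableSet_Ioi fun h hh => ?_
  have h0 : 0 < h := hh
  simp only [indicator_cone h0, indicator_truncCone h0]
  rw [lintegral_ballInd_sub_sq, lintegral_ballInd_sub_sq]
  gcongr
  exact min_le_left _ _

/-- What is left of the increment between `s` and `t` after subtracting the full cones lives at
heights above `T`, where each slice has measure at most a multiple of `|t - s|`. -/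
lemma lintegral_truncCone_sub_cone_sq_le (hH : H < 1 / 2) {T : ℝ} (hT : 0 < T) (s t : ℝ) :
    ∫⁻ z, ‖((truncCone T t).indicator (fun _ => (1 : ℝ)) z
          - (truncCone T s).indicator (fun _ => (1 : ℝ)) z)
        - ((cone t).indicator (fun _ => (1 : ℝ)) z
          - (cone s).indicator (fun _ => (1 : ℝ)) z)‖ₑ ^ (2 : ℝ) ∂controlMeasure H lam
      ≤ 8 * ENNReal.ofReal (lam ^ 2 * (T ^ (2 * H - 1) / (1 - 2 * H))) *
        ENNReal.ofReal |t - s| := by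
  have hc := measurable_indicator_cone
  have hc' := measurable_indicator_truncCone T
  have hslice : ∀ h ∈ Ioi (0 : ℝ),
      ENNReal.ofReal (lam ^ 2 * h ^ (2 * H - 2)) *
        ∫⁻ x, ‖((truncCone T t).indicator (fun _ => (1 : ℝ)) (x, h)
            - (truncCone T s).indicator (fun _ => (1 : ℝ)) (x, h))
          - ((cone t).indicator (fun _ => (1 : ℝ)) (x, h)
            - (cone s).indicator (fun _ => (1 : ℝ)) (x, h))‖ₑ ^ (2 : ℝ)
      ≤ (Ioi T).indicator (fun h => ENNReal.ofReal (lam ^ 2 * h ^ (2 * H - 2)) *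
          (8 * ENNReal.ofReal |t - s|)) h := by
    intro h h0
    rw [mem_Ioi] at h0
    simp only [indicator_cone h0, indicator_truncCone h0]
    rcases le_or_gt h T with hhT | hhT
    · simp [min_eq_left hhT]
    rw [indicator_of_mem (mem_Ioi.2 hhT)]
    gcongr
    have hb := fun r => (measurable_ballInd r t).fun_sub (measurable_ballInd r s)
    have hpt : ∀ a b : ℝ, ‖a - b‖ₑ ^ (2 : ℝ) ≤ 2 * ‖a‖ₑ ^ (2 : ℝ) + 2 * ‖b‖ₑ ^ (2 : ℝ) := by
      intro a b
      have h1 := ENNReal.rpow_add_le_mul_rpow_add_rpow ‖a‖ₑ ‖b‖ₑ (p := 2) (by norm_num)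
      rw [show (2 : ℝ) - 1 = 1 by norm_num, ENNReal.rpow_one, mul_add] at h1
      refine le_trans ?_ h1
      gcongr
      exact enorm_sub_le
    calc _ ≤ ∫⁻ x, (2 * ‖ballInd (min h T / 2) t x - ballInd (min h T / 2) s x‖ₑ ^ (2 : ℝ)
          + 2 * ‖ballInd (h / 2) t x - ballInd (h / 2) s x‖ₑ ^ (2 : ℝ)) :=
          lintegral_mono fun x => hpt _ _
      _ ≤ 2 * (2 * ENNReal.ofReal |t - s|) + 2 * (2 * ENNReal.ofReal |t - s|) := by
          rw [lintegral_add_left (((hb _).enorm.pow_const _).const_mul _),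
            lintegral_const_mul _ ((hb _).enorm.pow_const _),
            lintegral_const_mul _ ((hb _).enorm.pow_const _),
            lintegral_ballInd_sub_sq, lintegral_ballInd_sub_sq]
          gcongr <;> exact min_le_right _ _
      _ = 8 * ENNReal.ofReal |t - s| := by ring
  rw [lintegral_controlMeasure H lam
    ((((hc' t).fun_sub (hc' s)).fun_sub ((hc t).fun_sub (hc s))).enorm.pow_const _)]
  calc _ ≤ ∫⁻ h in Ioi 0, (Ioi T).indicator (fun h =>
        ENNReal.ofReal (lam ^ 2 * h ^ (2 * H - 2)) * (8 * ENNReal.ofReal |t - s|)) h :=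
        setLIntegral_mono' measurableSet_Ioi hslice
    _ = ∫⁻ h in Ioi T, ENNReal.ofReal (lam ^ 2 * h ^ (2 * H - 2)) *
          (8 * ENNReal.ofReal |t - s|) := by
        rw [lintegral_indicator measurableSet_Ioi, Measure.restrict_restrict measurableSet_Ioi,
          inter_eq_left.2 (Ioi_subset_Ioi hT.le)]
    _ = _ := by
        rw [lintegral_mul_const _ (by fun_prop), lintegral_Ioi_weight hH hT]
        ring

lemma controlMeasure_cone_diff_lt_top (hH0 : 0 < H) (hH : H < 1 / 2) (s t : ℝ) :
    controlMeasure H lam (cone t \ cone s) < ∞ := by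
  rw [← lintegral_indicator_one ((measurableSet_cone t).diff (measurableSet_cone s))]
  refine lt_of_le_of_lt (lintegral_mono fun z => ?_)
    ((lintegral_cone_sub_sq hH0 hH s t).trans_lt ENNReal.ofReal_lt_top)
  rw [enorm_indicator_sub_sq]
  exact le_self_add

end Cones

/-! ### Kolmogorov's condition for stochastic integrals -/

section

variable {S Ω : Type*} [MeasurableSpace S] [MeasurableSpace Ω] {G : Set S → Ω → ℝ}
  {μ : Measure S} {P : Measure Ω}

namespace IsGaussianWhiteNoise

/-- The covariance of two stochastic integrals, polarized. -/
lemma covariance_wienerInt_eq_half (hG : IsGaussianWhiteNoise G μ P)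
    (c d : FinMeasSet μ →₀ ℝ) :
    cov[wienerInt G c, wienerInt G d; P]
      = ((∫⁻ x, ‖stepFun c x‖ₑ ^ (2 : ℝ) ∂μ).toReal + (∫⁻ x, ‖stepFun d x‖ₑ ^ (2 : ℝ) ∂μ).toReal
        - (∫⁻ x, ‖stepFun (d - c) x‖ₑ ^ (2 : ℝ) ∂μ).toReal) / 2 := by
  have hsq : ∀ c : FinMeasSet μ →₀ ℝ,
      (∫⁻ x, ‖stepFun c x‖ₑ ^ (2 : ℝ) ∂μ).toReal = ∫ x, stepFun c x * stepFun c x ∂μ := fun c => by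
    rw [lintegral_enorm_stepFun_sq, ENNReal.toReal_ofReal
      (integral_nonneg fun x => mul_self_nonneg _)]
  have hi : ∀ c d : FinMeasSet μ →₀ ℝ, Integrable (fun x => stepFun c x * stepFun d x) μ :=
    fun c d => (memLp_stepFun c).integrable_mul (memLp_stepFun d)
  rw [hG.covariance_wienerInt, hsq, hsq, hsq]
  have e : ∫ x, stepFun (d - c) x * stepFun (d - c) x ∂μ
      = ∫ x, stepFun c x * stepFun c x ∂μ + ∫ x, stepFun d x * stepFun d x ∂μ
        - 2 * ∫ x, stepFun c x * stepFun d x ∂μ := by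
    rw [← integral_const_mul, ← integral_add (hi c c) (hi d d),
      ← integral_sub ((hi c c).fun_add (hi d d)) ((hi c d).const_mul 2)]
    refine integral_congr_ae (Eventually.of_forall fun x => ?_)
    simp only [stepFun_sub]
    ring
  rw [e]
  ring

/-- For stochastic integrals, a Hölder bound in `L²` on the integrands yields Kolmogorov's
condition with any exponent `p`. -/
lemma lintegral_edist_wienerInt_le (hG : IsGaussianWhiteNoise G μ P)
    {c : ℝ → FinMeasSet μ →₀ ℝ} {κ : ℝ≥0∞} {θ p : ℝ} (hp : 0 < p)
    (hc : ∀ s t, ∫⁻ x, ‖stepFun (c t - c s) x‖ₑ ^ (2 : ℝ) ∂μ ≤ κ * ENNReal.ofReal |t - s| ^ θ)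
    (s t : ℝ) :
    ∫⁻ w, edist (wienerInt G (c s) w) (wienerInt G (c t) w) ^ p ∂P
      ≤ κ ^ (p / 2) * gaussianMoment p * ENNReal.ofReal |t - s| ^ (θ * (p / 2)) := by
  simp_rw [edist_comm (wienerInt G (c s) _), edist_eq_enorm_sub, ← wienerInt_sub]
  rw [hG.lintegral_enorm_wienerInt_rpow _ hp]
  calc _ ≤ (κ * ENNReal.ofReal |t - s| ^ θ) ^ (p / 2) * gaussianMoment p := by
        gcongr
        exact hc s t
    _ = _ := by
        rw [ENNReal.mul_rpow_of_nonneg _ _ (by positivity), ← ENNReal.rpow_mul]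
        ring

lemma exists_continuous_modification_wienerInt [IsProbabilityMeasure P]
    (hG : IsGaussianWhiteNoise G μ P)
    {c : ℝ → FinMeasSet μ →₀ ℝ} {κ : ℝ≥0∞} {θ : ℝ} (hκ : κ ≠ ∞) (hθ : 0 < θ) (hθ2 : θ ≤ 2)
    (hc : ∀ s t, ∫⁻ x, ‖stepFun (c t - c s) x‖ₑ ^ (2 : ℝ) ∂μ ≤ κ * ENNReal.ofReal |t - s| ^ θ) :
    ∃ Y : ℝ → Ω → ℝ, (∀ t, Y t =ᵐ[P] wienerInt G (c t)) ∧ ∀ᵐ w ∂P, Continuous fun t => Y t w := by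
  -- with `p = 4 / θ` the exponent `θ p / 2` in Kolmogorov's condition is `2`
  have hp : 0 < 4 / θ := by positivity
  have hm := hG.lintegral_edist_wienerInt_le hp hc
  refine exists_continuous_modification (p := 4 / θ) (q := θ * (4 / θ / 2)) ?_ ?_ ?_
    (fun t => hG.aemeasurable_wienerInt _) hm
  · rw [le_div_iff₀ hθ]
    linarith
  · field_simp
    norm_num
  · exact ENNReal.mul_ne_top (ENNReal.rpow_ne_top_of_nonneg (by positivity) hκ)
      (gaussianMoment_ne_top hp)

end IsGaussianWhiteNoise

end

/-! ### The stationary and the fractional process as stochastic integrals -/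

variable {H lam : ℝ}

lemma amplitude_sq (hH0 : 0 < H) (hH : H < 1 / 2) :
    amplitude H lam ^ 2 = lam ^ 2 / (H * (1 - 2 * H)) := by
  have : 0 < 1 - 2 * H := by linarith
  exact Real.sq_sqrt (by positivity)

lemma amplitude_pos (hH0 : 0 < H) (hH : H < 1 / 2) (hlam : 0 < lam) : 0 < amplitude H lam := by
  have : 0 < 1 - 2 * H := by linarith
  exact Real.sqrt_pos.2 (by positivity)

/-- The integrand `1_{C_T(t)}` of the stationary process. -/
noncomputable def truncConeStep (lam : ℝ) (hH0 : 0 < H) (hH : H < 1 / 2) {T : ℝ} (hT : 0 < T)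
    (t : ℝ) : FinMeasSet (controlMeasure H lam) →₀ ℝ :=
  Finsupp.single ⟨truncCone T t, measurableSet_truncCone T t,
    controlMeasure_truncCone_lt_top hH0 hH hT t⟩ 1

/-- The integrand `1_{C(t)} - 1_{C(0)}` of the fractional Brownian motion. The two cones themselves
have infinite measure, so it is written as the difference of `1_{C(t) ∖ C(0)}` and
`1_{C(0) ∖ C(t)}`. -/
noncomputable def coneStep (lam : ℝ) (hH0 : 0 < H) (hH : H < 1 / 2) (t : ℝ) :
    FinMeasSet (controlMeasure H lam) →₀ ℝ :=
  Finsupp.single ⟨coneDiffPlus t, (measurableSet_cone t).diff (measurableSet_cone 0),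
    controlMeasure_cone_diff_lt_top hH0 hH 0 t⟩ 1
  - Finsupp.single ⟨coneDiffMinus t, (measurableSet_cone 0).diff (measurableSet_cone t),
    controlMeasure_cone_diff_lt_top hH0 hH t 0⟩ 1

lemma stepFun_truncConeStep (hH0 : 0 < H) (hH : H < 1 / 2) {T : ℝ} (hT : 0 < T) (t : ℝ)
    (z : ℝ × ℝ) :
    stepFun (truncConeStep lam hH0 hH hT t) z = (truncCone T t).indicator (fun _ => 1) z := by
  rw [truncConeStep, stepFun_single, one_mul]

lemma stepFun_coneStep (hH0 : 0 < H) (hH : H < 1 / 2) (t : ℝ) (z : ℝ × ℝ) :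
    stepFun (coneStep lam hH0 hH t) z
      = (cone t).indicator (fun _ => 1) z - (cone 0).indicator (fun _ => 1) z := by
  rw [coneStep, stepFun_sub, stepFun_single, stepFun_single]
  by_cases h1 : z ∈ cone t <;> by_cases h2 : z ∈ cone 0 <;>
    simp [coneDiffPlus, coneDiffMinus, h1, h2]

lemma stepFun_coneStep_sub (hH0 : 0 < H) (hH : H < 1 / 2) (s t : ℝ) (z : ℝ × ℝ) :
    stepFun (coneStep lam hH0 hH t - coneStep lam hH0 hH s) z
      = (cone t).indicator (fun _ => 1) z - (cone s).indicator (fun _ => 1) z := by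
  rw [stepFun_sub, stepFun_coneStep, stepFun_coneStep]
  ring

lemma lintegral_coneStep_sub_sq (hH0 : 0 < H) (hH : H < 1 / 2) (s t : ℝ) :
    ∫⁻ z, ‖stepFun (coneStep lam hH0 hH t - coneStep lam hH0 hH s) z‖ₑ ^ (2 : ℝ)
        ∂controlMeasure H lam
      = ENNReal.ofReal (amplitude H lam ^ 2 * |t - s| ^ (2 * H)) := by
  simp_rw [stepFun_coneStep_sub]
  rw [lintegral_cone_sub_sq hH0 hH, amplitude_sq hH0 hH]

lemma lintegral_coneStep_sq (hH0 : 0 < H) (hH : H < 1 / 2) (t : ℝ) :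
    ∫⁻ z, ‖stepFun (coneStep lam hH0 hH t) z‖ₑ ^ (2 : ℝ) ∂controlMeasure H lam
      = ENNReal.ofReal (amplitude H lam ^ 2 * |t| ^ (2 * H)) := by
  have h := lintegral_coneStep_sub_sq (lam := lam) hH0 hH 0 t
  rw [sub_zero] at h
  rw [← h]
  simp_rw [stepFun_coneStep_sub, stepFun_coneStep]

lemma ofReal_amplitude_sq_mul (hH0 : 0 < H) (x : ℝ) :
    ENNReal.ofReal (amplitude H lam ^ 2 * |x| ^ (2 * H))
      = ENNReal.ofReal (amplitude H lam ^ 2) * ENNReal.ofReal |x| ^ (2 * H) := by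
  rw [ENNReal.ofReal_mul (sq_nonneg _),
    ENNReal.ofReal_rpow_of_nonneg (abs_nonneg _) (by positivity)]

variable {Ω : Type*} [MeasurableSpace Ω] {P : Measure Ω} [IsProbabilityMeasure P]
  {G : Set (ℝ × ℝ) → Ω → ℝ}

lemma exists_isStationaryFBM (hH0 : 0 < H) (hH : H < 1 / 2)
    (hG : IsGaussianWhiteNoise G (controlMeasure H lam) P) {T : ℝ} (hT : 0 < T) (m : ℝ) :
    ∃ X : ℝ → Ω → ℝ, IsStationaryFBM G T m X P := by
  obtain ⟨Y, hY, hYc⟩ := hG.exists_continuous_modification_wienerInt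
    (c := truncConeStep lam hH0 hH hT) (κ := ENNReal.ofReal (amplitude H lam ^ 2)) (θ := 2 * H)
    ENNReal.ofReal_ne_top (by linarith) (by linarith) fun s t => by
      rw [← ofReal_amplitude_sq_mul hH0, amplitude_sq hH0 hH]
      simp_rw [stepFun_sub, stepFun_truncConeStep]
      exact lintegral_truncCone_sub_sq_le hH0 hH T s t
  refine ⟨fun t w => m + Y t w, fun t => ?_, ?_⟩
  · filter_upwards [hY t] with w hw
    rw [hw, truncConeStep, wienerInt_single, one_mul]
  · filter_upwards [hYc] with w hw using hw.const_add m

/-- A continuous modification of `ν⁻¹ ∫ (1_{C(t)} - 1_{C(0)}) dG` is a fractional Brownian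
motion. -/
lemma exists_isFractionalBrownianMotion (hH0 : 0 < H) (hH : H < 1 / 2) (hlam : 0 < lam)
    (hG : IsGaussianWhiteNoise G (controlMeasure H lam) P) :
    ∃ B : ℝ → Ω → ℝ, IsFractionalBrownianMotion H B P ∧
      ∀ t, (fun w => amplitude H lam * B t w) =ᵐ[P] wienerInt G (coneStep lam hH0 hH t) := by
  obtain ⟨Y, hY, hYc⟩ := hG.exists_continuous_modification_wienerInt
    (c := coneStep lam hH0 hH) (κ := ENNReal.ofReal (amplitude H lam ^ 2)) (θ := 2 * H)
    ENNReal.ofReal_ne_top (by linarith) (by linarith) fun s t => by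
      rw [← ofReal_amplitude_sq_mul hH0, lintegral_coneStep_sub_sq]
  have hν := (amplitude_pos hH0 hH hlam).ne'
  set ν := amplitude H lam with hνdef
  have hB : ∀ t, wienerInt G (ν⁻¹ • coneStep lam hH0 hH t) =ᵐ[P] fun w => ν⁻¹ * Y t w := fun t => by
    filter_upwards [hY t] with w hw
    rw [wienerInt_smul, hw]
  refine ⟨fun t w => ν⁻¹ * Y t w, ⟨?_, fun t => ?_, fun s t => ?_, ?_⟩, fun t => ?_⟩
  · exact (hG.isGaussianProcess_wienerInt.comp_right fun t => ν⁻¹ • coneStep lam hH0 hH t).congr hB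
  · rw [← integral_congr_ae (hB t), hG.integral_wienerInt]
  · have h0 : ∀ x : ℝ, 0 ≤ ν ^ 2 * |x| ^ (2 * H) := fun x => by positivity
    have hcov : cov[Y s, Y t; P]
        = cov[wienerInt G (coneStep lam hH0 hH s), wienerInt G (coneStep lam hH0 hH t); P] := by
      simp only [covariance, integral_congr_ae (hY s), integral_congr_ae (hY t)]
      refine integral_congr_ae ?_
      filter_upwards [hY s, hY t] with w h1 h2
      rw [h1, h2]
    rw [covariance_const_mul_left, covariance_const_mul_right, hcov,
      hG.covariance_wienerInt_eq_half, lintegral_coneStep_sq, lintegral_coneStep_sq,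
      lintegral_coneStep_sub_sq, ENNReal.toReal_ofReal (h0 _), ENNReal.toReal_ofReal (h0 _),
      ENNReal.toReal_ofReal (h0 _)]
    field_simp
  · filter_upwards [hYc] with w hw using hw.const_mul _
  · filter_upwards [hY t] with w hw
    rw [mul_inv_cancel_left₀ hν, hw]

/-! ### Convergence -/

/-- The maximal inequality for the difference between the stationary process and `ν B_H`. -/
lemma lintegral_iSup_sub_le (hH0 : 0 < H) (hH : H < 1 / 2)
    (hG : IsGaussianWhiteNoise G (controlMeasure H lam) P) {B : ℝ → Ω → ℝ}
    (hBc : ∀ᵐ w ∂P, Continuous fun t => B t w)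
    (hB : ∀ t, (fun w => amplitude H lam * B t w) =ᵐ[P] wienerInt G (coneStep lam hH0 hH t))
    {T : ℝ} (hT : 0 < T) {m : ℝ} {X : ℝ → Ω → ℝ} (hX : IsStationaryFBM G T m X P)
    {t₀ : ℝ} {N : ℕ} (hN : t₀ < N) :
    ∫⁻ w, ⨆ t ∈ Icc 0 t₀, ENNReal.ofReal |X t w - X 0 w - amplitude H lam * B t w| ∂P
      ≤ (N + 1) * ((2 * N * ((8 * ENNReal.ofReal (lam ^ 2 * (T ^ (2 * H - 1) / (1 - 2 * H)))) ^
        ((4 : ℝ) / 2) * gaussianMoment 4)) ^ ((1 : ℝ) / 4) * chainingConst 4 2) := by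
  set ν := amplitude H lam with hν
  set c : ℝ → FinMeasSet (controlMeasure H lam) →₀ ℝ :=
    fun t => truncConeStep lam hH0 hH hT t - coneStep lam hH0 hH t with hc
  set κ := 8 * ENNReal.ofReal (lam ^ 2 * (T ^ (2 * H - 1) / (1 - 2 * H))) with hκ
  have hD : ∀ t, (fun w => X t w - ν * B t w) =ᵐ[P] fun w => m + wienerInt G (c t) w := fun t => by
    filter_upwards [hX.eq_noise t, hB t] with w h1 h2
    rw [h1, h2, hc, wienerInt_sub, truncConeStep, wienerInt_single]
    ring
  have hinc : ∀ s t, ∫⁻ z, ‖stepFun (c t - c s) z‖ₑ ^ (2 : ℝ) ∂controlMeasure H lam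
      ≤ κ * ENNReal.ofReal |t - s| ^ (1 : ℝ) := fun s t => by
    rw [ENNReal.rpow_one]
    refine le_trans (le_of_eq ?_) (lintegral_truncCone_sub_cone_sq_le hH hT s t)
    refine lintegral_congr fun z => ?_
    rw [hc]
    simp only [stepFun_sub, stepFun_truncConeStep, stepFun_coneStep]
    congr 2
    ring
  have hmoment : ∀ s t, ∫⁻ w, edist (X s w - ν * B s w) (X t w - ν * B t w) ^ (4 : ℝ) ∂P
      ≤ κ ^ ((4 : ℝ) / 2) * gaussianMoment 4 * ENNReal.ofReal |t - s| ^ (2 : ℝ) := fun s t => by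
    have h := hG.lintegral_edist_wienerInt_le (p := 4) (by norm_num) hinc s t
    rw [show (1 : ℝ) * (4 / 2) = 2 by norm_num] at h
    refine le_trans (le_of_eq (lintegral_congr_ae ?_)) h
    filter_upwards [hD s, hD t] with w h1 h2
    rw [h1, h2, edist_add_left]
  have hmeas : ∀ t, AEMeasurable (fun w => X t w - ν * B t w) P := fun t =>
    ((hG.aemeasurable_wienerInt (c t)).const_add m).congr (hD t).symm
  have hcont : ∀ᵐ w ∂P, Continuous fun t => X t w - ν * B t w := by
    filter_upwards [hX.continuous_paths, hBc] with w h1 h2 using h1.sub (h2.const_mul _)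
  -- at time `0` the integrand of `ν B` vanishes
  have hB0 : ∀ᵐ w ∂P, ν * B 0 w = 0 := by
    have h0 : wienerInt G (coneStep lam hH0 hH 0) =ᵐ[P]
        wienerInt G (0 : FinMeasSet (controlMeasure H lam) →₀ ℝ) :=
      hG.wienerInt_ae_eq fun z => by rw [stepFun_coneStep, sub_self]; simp [stepFun]
    filter_upwards [hB 0, h0] with w h1 h2
    rw [h1, h2]
    simp [wienerInt]
  refine le_trans (lintegral_mono_ae ?_)
    (lintegral_iSup_edist_le (by norm_num) hmeas hcont hmoment N)
  filter_upwards [hB0] with w hw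
  refine iSup₂_le fun t ht => ?_
  refine le_trans (le_of_eq ?_) (le_iSup₂ (f := fun t (_ : t ∈ Ico (0 : ℝ) N) =>
    edist (X t w - ν * B t w) (X 0 w - ν * B 0 w)) t ⟨ht.1, ht.2.trans_lt hN⟩)
  rw [edist_dist, Real.dist_eq, hw]
  congr 2
  ring

end SfBM

theorem proposition1 {Ω : Type*} [MeasurableSpace Ω] (P : Measure Ω) [IsProbabilityMeasure P]
    (H lam : ℝ) (hH_pos : 0 < H) (hH_lt : H < 1 / 2) (hlam : 0 < lam)
    (G : Set (ℝ × ℝ) → Ω → ℝ)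
    (hG : SfBM.IsGaussianWhiteNoise G (SfBM.controlMeasure H lam) P) :
    (∀ T : ℝ, 0 < T → ∀ m : ℝ, ∃ X : ℝ → Ω → ℝ, SfBM.IsStationaryFBM G T m X P) ∧
    ∃ B : ℝ → Ω → ℝ,
      SfBM.IsFractionalBrownianMotion H B P ∧
      (∀ t : ℝ, (fun w => SfBM.amplitude H lam * B t w) =ᵐ[P]
        fun w => G (SfBM.coneDiffPlus t) w - G (SfBM.coneDiffMinus t) w) ∧
      ∀ (m : ℝ → ℝ) (X : ℝ → ℝ → Ω → ℝ),
        (∀ T : ℝ, 0 < T → SfBM.IsStationaryFBM G T (m T) (X T) P) →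
        ∀ t₀ : ℝ, 0 < t₀ →
          Tendsto
            (fun T : ℝ => ∫⁻ w, ⨆ t ∈ Set.Icc (0 : ℝ) t₀,
              ENNReal.ofReal |X T t w - X T 0 w - SfBM.amplitude H lam * B t w| ∂P)
            atTop (𝓝 0) := by
  refine ⟨fun T hT m => SfBM.exists_isStationaryFBM hH_pos hH_lt hG hT m, ?_⟩
  obtain ⟨B, hfBm, hB⟩ := SfBM.exists_isFractionalBrownianMotion hH_pos hH_lt hlam hG
  refine ⟨B, hfBm, fun t => ?_, fun m X hX t₀ _ => ?_⟩
  · filter_upwards [hB t] with w hw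
    rw [hw, SfBM.coneStep, SfBM.wienerInt_sub, SfBM.wienerInt_single, SfBM.wienerInt_single,
      one_mul, one_mul]
  obtain ⟨N, hN⟩ := exists_nat_gt t₀
  have hdecay : Tendsto (fun T : ℝ => lam ^ 2 * (T ^ (2 * H - 1) / (1 - 2 * H))) atTop (𝓝 0) := by
    have h := tendsto_rpow_neg_atTop (show 0 < 1 - 2 * H by linarith)
    rw [neg_sub] at h
    simpa using (h.div_const (1 - 2 * H)).const_mul (lam ^ 2)
  have hκ : Tendsto (fun T : ℝ => 8 * ENNReal.ofReal (lam ^ 2 * (T ^ (2 * H - 1) / (1 - 2 * H))))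
      atTop (𝓝 0) := by
    simpa using ENNReal.Tendsto.const_mul (ENNReal.tendsto_ofReal hdecay) (a := 8)
      (Or.inr (by norm_num))
  have hM : SfBM.gaussianMoment 4 ≠ ∞ := SfBM.gaussianMoment_ne_top (by norm_num)
  have hC : SfBM.chainingConst 4 2 ≠ ∞ := SfBM.chainingConst_ne_top (by norm_num) (by norm_num)
  have hbound : Tendsto (fun T : ℝ => ((N : ℝ≥0∞) + 1) * ((2 * N *
      ((8 * ENNReal.ofReal (lam ^ 2 * (T ^ (2 * H - 1) / (1 - 2 * H)))) ^ ((4 : ℝ) / 2) *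
        SfBM.gaussianMoment 4)) ^ ((1 : ℝ) / 4) * SfBM.chainingConst 4 2)) atTop (𝓝 0) := by
    have h1 := ENNReal.Tendsto.mul_const (hκ.ennrpow_const ((4 : ℝ) / 2)) (Or.inr hM)
    have h2 := ENNReal.Tendsto.const_mul h1 (a := 2 * (N : ℝ≥0∞)) (Or.inr (by finiteness))
    have h3 := ENNReal.Tendsto.mul_const (h2.ennrpow_const ((1 : ℝ) / 4)) (Or.inr hC)
    have h4 := ENNReal.Tendsto.const_mul h3 (a := (N : ℝ≥0∞) + 1) (Or.inr (by finiteness))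
    simpa using h4
  refine tendsto_of_tendsto_of_tendsto_of_le_of_le' tendsto_const_nhds hbound
    (Eventually.of_forall fun _ => zero_le) ?_
  filter_upwards [eventually_gt_atTop 0] with T hT
  exact SfBM.lintegral_iSup_sub_le hH_pos hH_lt hG hfBm.continuous_paths hB hT (hX T hT) hN
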